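/- Let $n\ge 1$, write $x=(x',x_n)\in\mathbb R^{n-1}\times\mathbb R$, and let $\varphi:\mathbb R^{n-1}\to\mathbb R$ be Lipschitz continuous with $\varphi(x')\to+\infty$ as $|x'|\to\infty$ (for $n=1$, $\varphi$ is a constant). Let $\Omega=\{x\in\mathbb R^n : x_n>\varphi(x')\}$ (a Lipschitz coercive epigraph) and $l=\inf\varphi$. The logarithmic Laplacian is $$L_\Delta u(x)=C_n\lim_{\varepsilon\to0^+}\int_{|x-y|>\varepsilon}\frac{u(x)1_{B_1(x)}(y)-u(y)}{|x-y|^n}\,dy+\rho_n u(x),$$ where $C_n=\pi^{-n/2}\Gamma(n/2)$ and $\rho_n=2\ln2+\psi(n/2)-\gamma$, with $\psi=\Gamma'/\Gamma$ and $\gamma$ the Euler–Mascheroni constant. Let $a$ be a real function on $(l,\infty)$ and $f$ a real function on $(0,\infty)$ such that (i) $a$ is continuous and nondecreasing on $(l,\infty)$; (ii) $\limsup_{h\to0^+}\dfrac{a(l+h)}{-\ln h}\le 0$; (iii) $f$ is locally Lipschitz continuous, nondecreasing and positive on $(0,\infty)$. Let $u:\mathbb R^n\to\mathbb R$ be bounded,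 with $\int_{\mathbb R^n}\frac{|u(x)|}{1+|x|^n}\,dx<\infty$, $u\in C^{1,1}_{loc}(\Omega)\cap C(\overline\Omega)$ and $u>0$ in $\Omega$, and suppose that $$L_\Delta u(x)=a(x_n)f(u(x))\ \text{ for } x\in\Omega,\qquad u(x)=0\ \text{ for } x\in\mathbb R^n\setminus\Omega .$$ Then $u$ is strictly increasing in the $x_n$-direction in $\Omega$: if $(x',s),(x',t)\in\Omega$ and $s<t$, then $u(x',s)<u(x',t)$. (No positivity of $a$ is assumed; in particular the statement covers the case in which $a(t)>0$ for some $t>l$.) -/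

import Mathlib

open MeasureTheory Filter Topology Set

noncomputable section

namespace LogLap

/-- The Euclidean space `ℝ^n`. -/
abbrev E (n : ℕ) : Type := EuclideanSpace ℝ (Fin n)

/-- The first `m` coordinates `x'` of a point `x = (x', x_n)` of `ℝ^n`, where `n = m + 1`. -/
def horiz {m : ℕ} (x : E (m + 1)) : E m := WithLp.toLp 2 fun i : Fin m => x i.castSucc

/-- The last coordinate `x_n` of a point `x = (x', x_n)` of `ℝ^n`, where `n = m + 1`. -/
def height {m : ℕ} (x : E (m + 1)) : ℝ := x (Fin.last m)

/-- The epigraph `{x | x_n > φ(x')}`. -/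
def epigraph {m : ℕ} (φ : E m → ℝ) : Set (E (m + 1)) := {x | φ (horiz x) < height x}

/-- `φ` is Lipschitz continuous and `φ(x') → +∞` as `|x'| → ∞`. -/
structure IsLipschitzCoercive {m : ℕ} (φ : E m → ℝ) : Prop where
  lipschitz : ∃ K, LipschitzWith K φ
  coercive : Tendsto φ (comap norm atTop) atTop

/-- The number `l = inf φ`. -/
def bottom {m : ℕ} (φ : E m → ℝ) : ℝ := ⨅ x', φ x'

/-- The weighted space `L_0` of functions with `∫ |u(x)| / (1 + |x|^n) dx < ∞`. -/
def MemL0 {n : ℕ} (u : E n → ℝ) : Prop :=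
  Integrable (fun x => u x / (1 + ‖x‖ ^ n)) volume

/-- `u` is of class `C^{1,1}_loc` in the open set `U`: differentiable, with locally Lipschitz
derivative. -/
def IsC11Loc {n : ℕ} (u : E n → ℝ) (U : Set (E n)) : Prop :=
  DifferentiableOn ℝ u U ∧ LocallyLipschitzOn U (fderiv ℝ u)

/-- The normalization constant `C_n = π^{-n/2} Γ(n/2)`. -/
def constC (n : ℕ) : ℝ := Real.pi ^ (-(n : ℝ) / 2) * Real.Gamma ((n : ℝ) / 2)

/-- The constant `ρ_n = 2 ln 2 + ψ(n/2) - γ`, where `ψ = Γ'/Γ`. -/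
def constRho (n : ℕ) : ℝ :=
  2 * Real.log 2 + deriv Real.Gamma ((n : ℝ) / 2) / Real.Gamma ((n : ℝ) / 2)
    - Real.eulerMascheroniConstant

/-- The integrand `(u(x) 1_{B_1(x)}(y) - u(y)) / |x - y|^n`. -/
def integrand {n : ℕ} (u : E n → ℝ) (x y : E n) : ℝ :=
  ((Metric.ball x 1).indicator (fun _ => u x) y - u y) / ‖x - y‖ ^ n

/-- `L_Δ u(x)` exists and equals `v`: the truncated integrals over `{|x - y| > ε}` exist, and
`C_n` times their limit as `ε → 0⁺` (the principal value), plus `ρ_n u(x)`, is `v`. -/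
def HasLogLaplacianAt {n : ℕ} (u : E n → ℝ) (x : E n) (v : ℝ) : Prop :=
  (∀ ε : ℝ, 0 < ε → IntegrableOn (integrand u x) (Metric.closedBall x ε)ᶜ volume) ∧
  Tendsto
    (fun ε : ℝ => constC n * (∫ y in (Metric.closedBall x ε)ᶜ, integrand u x y)
      + constRho n * u x)
    (𝓝[>] 0) (𝓝 v)

/-- `u` solves `L_Δ u = a(x_n) f(u)` in `Ω` and `u = 0` outside `Ω`. -/
structure IsSolution {m : ℕ} (Ω : Set (E (m + 1))) (a f : ℝ → ℝ) (u : E (m + 1) → ℝ) :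
    Prop where
  equation : ∀ x ∈ Ω, HasLogLaplacianAt u x (a (height x) * f (u x))
  exterior : ∀ x ∉ Ω, u x = 0

end LogLap

end

/-!
The proof is a moving plane argument that rests on two maximum principles, preceded by a reduction
to a negative coefficient. Throughout `K(x, y) = |x - y|^{-n}`, `x^λ = (x', 2λ - x_n)` and
`w_λ(x) = u(x^λ) - u(x)`.

*The coefficient is negative* (`IsSolution.coeff_neg`). The symbol of the logarithmic Laplacian is
`2 ln |ξ|`, so it is negative at low frequencies, and a large ball carries positive strict
subsolutions: `exists_tent_subsolution` shows that the tent function `(1 - |x - z| / R)₊` is one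
when `R` is large. If `a(t) ≥ 0` for some `t > l`, then `a ≥ 0` above height `t`, where the epigraph
contains balls of every radius. Sliding a multiple of the tent function up until it touches `u` from
below at `x` gives `L_Δ u(x) < 0` (`exists_hasLogLaplacianAt_neg`), whereas
`L_Δ u(x) = a(x_n) f(u(x)) ≥ 0`. Hence `a < 0` on `(l, ∞)`.

*Antisymmetric maximum principles.* Pairing `y` with `y^λ` in the principal value turns the kernel
into `K(x, y) - K(x, y^λ) > 0` on the half space `x_n < λ` (`HasLogLaplacianAt.le_of_antisymm`).
At a negative minimum `-M` of `w_λ` this yields, with `N` the set in the half space where `w_λ < 0`,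
`L_Δ w_λ(x) ≤ M (C_n ∫_N K - C_n ∫_{B_1(x)} K - ρ_n)`, the integrals being truncated near `x`.
Since `K` is not integrable at `x`, the right side is negative once `|N|` is small
(`exists_volume_threshold`). At a zero of a nonnegative, not identically vanishing `w_λ` it yields
`L_Δ w_λ(x) < 0` (`HasLogLaplacianAt.neg_of_antisymm`).

*Moving the plane* (`IsSolution.reflDiff_nonneg`). At a negative minimum of `w_λ` the signs and
monotonicity of `a` and `f` give `L_Δ w_λ ≥ 0`, so `w_λ ≥ 0` as soon as `|{w_λ < 0}|` is small. This
set lies in a bounded part of the epigraph, and its volume tends to `0` as `λ` decreases to `l`, and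
also as `λ` decreases to any position at which `w` is positive in the epigraph below the plane.
Positivity is inherited in the limit by the strong maximum principle, so the plane reaches every
height, and `w_λ > 0` with `λ = (s + t) / 2` is the claim.
-/

namespace LogLap

/-! ### The kernel `|x - y|^{-n}` and its integrals over annuli -/

/-- The kernel `|x - y|^{-n}` of the logarithmic Laplacian, with value `0` at `y = x` for `n ≥ 1`. -/
noncomputable def kernel {n : ℕ} (x y : E n) : ℝ := (‖x - y‖ ^ n)⁻¹

/-- The open annulus `{y | r < |x - y| < s}`. -/
def annulus {n : ℕ} (x : E n) (r s : ℝ) : Set (E n) := {y | ‖x - y‖ ∈ Ioo r s}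

/-- The area of the unit sphere of `ℝ^n`, as `n` times the volume of the unit ball. -/
noncomputable def sphereArea (n : ℕ) : ℝ := n * volume.real (Metric.ball (0 : E n) 1)

lemma sphereArea_pos (m : ℕ) : 0 < sphereArea (m + 1) := by
  unfold sphereArea
  have : 0 < volume.real (Metric.ball (0 : E (m + 1)) 1) :=
    ENNReal.toReal_pos (Metric.measure_ball_pos _ _ one_pos).ne' measure_ball_lt_top.ne
  positivity

lemma kernel_nonneg {n : ℕ} (x y : E n) : 0 ≤ kernel x y := by
  unfold kernel; positivity

lemma kernel_le {n : ℕ} {x y : E n} {r : ℝ} (hr : 0 < r) (h : r ≤ ‖x - y‖) :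
    kernel x y ≤ (r ^ n)⁻¹ := by
  unfold kernel; gcongr

lemma le_kernel {n : ℕ} {x y : E n} {r : ℝ} (h0 : x ≠ y) (h : ‖x - y‖ ≤ r) :
    (r ^ n)⁻¹ ≤ kernel x y := by
  unfold kernel
  have : 0 < ‖x - y‖ := norm_pos_iff.2 (sub_ne_zero.2 h0)
  gcongr

lemma measurable_kernel {n : ℕ} (x : E n) : Measurable (kernel x) := by
  unfold kernel; fun_prop

lemma measurableSet_annulus {n : ℕ} (x : E n) (r s : ℝ) : MeasurableSet (annulus x r s) :=
  measurableSet_Ioo.preimage (by fun_prop : Measurable fun y => ‖x - y‖)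

lemma mem_compl_closedBall {n : ℕ} {x y : E n} {r : ℝ} :
    y ∈ (Metric.closedBall x r)ᶜ ↔ r < ‖x - y‖ := by
  rw [mem_compl_iff, Metric.mem_closedBall, not_le, dist_comm, dist_eq_norm]

lemma mem_ball_iff_norm_sub {n : ℕ} {x y : E n} {r : ℝ} :
    y ∈ Metric.ball x r ↔ ‖x - y‖ < r := by
  rw [Metric.mem_ball, dist_comm, dist_eq_norm]

lemma annulus_subset_ball {n : ℕ} (x : E n) (r s : ℝ) : annulus x r s ⊆ Metric.ball x s :=
  fun _ hy => mem_ball_iff_norm_sub.2 hy.2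

/-- A bounded measurable function is integrable over a set of finite volume. -/
lemma integrableOn_of_le {n : ℕ} {f : E n → ℝ} {s : Set (E n)} {C : ℝ} (hf : Measurable f)
    (hs : MeasurableSet s) (hv : volume s ≠ ⊤) (hb : ∀ y ∈ s, |f y| ≤ C) :
    IntegrableOn f s volume :=
  Measure.integrableOn_of_bounded hv hf.aestronglyMeasurable
    ((ae_restrict_iff' hs).2 (Eventually.of_forall hb))

lemma integrableOn_kernel {n : ℕ} (x : E n) {s : Set (E n)} {r : ℝ} (hr : 0 < r)
    (hs : MeasurableSet s) (hv : volume s ≠ ⊤) (hb : ∀ y ∈ s, r ≤ ‖x - y‖) :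
    IntegrableOn (kernel x) s volume :=
  integrableOn_of_le (measurable_kernel x) hs hv fun y hy => by
    rw [abs_of_nonneg (kernel_nonneg x y)]; exact kernel_le hr (hb y hy)

lemma integral_annulus_radial {m : ℕ} (x : E (m + 1)) {r s : ℝ} (hr : 0 < r) (hrs : r ≤ s)
    (f : ℝ → ℝ) :
    ∫ y in annulus x r s, f ‖x - y‖ = sphereArea (m + 1) * ∫ t in r..s, t ^ m * f t := by
  have h1 : ∫ y in annulus x r s, f ‖x - y‖
      = ∫ y, (Ioo r s).indicator f ‖x - y‖ := by
    rw [← integral_indicator (measurableSet_annulus x r s)]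
    rfl
  rw [h1, integral_sub_left_eq_self (fun z : E (m + 1) => (Ioo r s).indicator f ‖z‖) volume x,
    integral_fun_norm_addHaar]
  have h2 : ∫ t in Ioi (0 : ℝ), t ^ m * (Ioo r s).indicator f t = ∫ t in r..s, t ^ m * f t := by
    rw [intervalIntegral.integral_of_le hrs, integral_Ioc_eq_integral_Ioo,
      ← integral_indicator measurableSet_Ioi, ← integral_indicator measurableSet_Ioo]
    congr 1
    ext t
    by_cases ht : t ∈ Ioo r s
    · have : t ∈ Ioi (0 : ℝ) := hr.trans ht.1
      simp [indicator_of_mem ht, indicator_of_mem this]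
    · by_cases h0 : t ∈ Ioi (0 : ℝ)
      · simp [indicator_of_notMem ht, indicator_of_mem h0]
      · simp [indicator_of_notMem ht, indicator_of_notMem h0]
  simp only [finrank_euclideanSpace, Fintype.card_fin, Nat.add_sub_cancel, smul_eq_mul,
    nsmul_eq_mul, h2, sphereArea]
  ring

lemma integral_annulus_kernel {m : ℕ} (x : E (m + 1)) {r s : ℝ} (hr : 0 < r) (hrs : r ≤ s) :
    ∫ y in annulus x r s, kernel x y = sphereArea (m + 1) * Real.log (s / r) := by
  have := integral_annulus_radial x hr hrs fun t => (t ^ (m + 1))⁻¹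
  rw [show (∫ y in annulus x r s, kernel x y) = ∫ y in annulus x r s, (‖x - y‖ ^ (m + 1))⁻¹
    from rfl, this, ← integral_inv_of_pos hr (hr.trans_le hrs)]
  congr 1
  refine intervalIntegral.integral_congr fun t ht => ?_
  rw [uIcc_of_le hrs] at ht
  have : t ≠ 0 := (hr.trans_le ht.1).ne'
  field_simp
  ring

lemma integral_annulus_norm_mul_kernel_le {m : ℕ} (x : E (m + 1)) {r : ℝ} (hr : 0 < r)
    (hr1 : r ≤ 1) :
    ∫ y in annulus x r 1, ‖x - y‖ * kernel x y ≤ sphereArea (m + 1) := by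
  have := integral_annulus_radial x hr hr1 fun t => t * (t ^ (m + 1))⁻¹
  rw [show (∫ y in annulus x r 1, ‖x - y‖ * kernel x y)
    = ∫ y in annulus x r 1, ‖x - y‖ * (‖x - y‖ ^ (m + 1))⁻¹ from rfl, this]
  have h : ∫ t in r..1, t ^ m * (t * (t ^ (m + 1))⁻¹) = 1 - r := by
    rw [show (1 - r : ℝ) = ∫ t in r..1, (1 : ℝ) by simp]
    refine intervalIntegral.integral_congr fun t ht => ?_
    rw [uIcc_of_le hr1] at ht
    have : t ≠ 0 := (hr.trans_le ht.1).ne'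
    field_simp
    ring
  rw [h]
  nlinarith [sphereArea_pos m]

lemma constC_pos (m : ℕ) : 0 < constC (m + 1) := by
  unfold constC
  have : 0 < Real.Gamma (((m + 1 : ℕ) : ℝ) / 2) := Real.Gamma_pos_of_pos (by positivity)
  positivity

/-! ### Reflection in a horizontal hyperplane -/

/-- The reflection `(x', x_n) ↦ (x', -x_n)`, as a linear isometry. -/
noncomputable def flipHeight (m : ℕ) : E (m + 1) ≃ₗᵢ[ℝ] E (m + 1) :=
  LinearIsometryEquiv.piLpCongrRight 2 fun i =>
    if i = Fin.last m then LinearIsometryEquiv.neg ℝ else LinearIsometryEquiv.refl ℝ ℝ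

/-- The reflection `(x', x_n) ↦ (x', 2λ - x_n)` in the hyperplane `x_n = λ`. -/
noncomputable def mirror {m : ℕ} (l : ℝ) (x : E (m + 1)) : E (m + 1) :=
  flipHeight m x + EuclideanSpace.single (Fin.last m) (2 * l)

@[simp] lemma height_mirror {m : ℕ} (l : ℝ) (x : E (m + 1)) :
    height (mirror l x) = 2 * l - height x := by
  simp [height, mirror, flipHeight]; ring

@[simp] lemma horiz_mirror {m : ℕ} (l : ℝ) (x : E (m + 1)) : horiz (mirror l x) = horiz x := by
  ext i
  simp [horiz, mirror, flipHeight, Fin.castSucc_ne_last]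

lemma ext_horiz_height {m : ℕ} {x y : E (m + 1)} (h : horiz x = horiz y)
    (h' : height x = height y) : x = y := by
  ext i
  induction i using Fin.lastCases with
  | last => exact h'
  | cast i => exact congrFun (congrArg WithLp.ofLp h) i

@[simp] lemma mirror_mirror {m : ℕ} (l : ℝ) (x : E (m + 1)) : mirror l (mirror l x) = x :=
  ext_horiz_height (by simp) (by simp)

lemma measurePreserving_mirror {m : ℕ} (l : ℝ) :
    MeasurePreserving (mirror l : E (m + 1) → E (m + 1)) volume volume :=
  (measurePreserving_add_right volume _).comp (flipHeight m).measurePreserving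

lemma continuous_mirror {m : ℕ} (l : ℝ) : Continuous (mirror l : E (m + 1) → E (m + 1)) :=
  (flipHeight m).continuous.add continuous_const

lemma continuous_mirror_left {m : ℕ} (x : E (m + 1)) : Continuous fun l => mirror l x := by
  unfold mirror
  refine continuous_const.add ?_
  have : (fun l : ℝ => EuclideanSpace.single (Fin.last m) (2 * l))
      = fun l : ℝ => (2 * l) • EuclideanSpace.single (Fin.last m) (1 : ℝ) := by
    ext l i; simp
  rw [this]; fun_prop

lemma measurableEmbedding_mirror {m : ℕ} (l : ℝ) :
    MeasurableEmbedding (mirror l : E (m + 1) → E (m + 1)) :=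
  (MeasurableEquiv.mk ⟨mirror l, mirror l, mirror_mirror l, mirror_mirror l⟩
    (continuous_mirror l).measurable (continuous_mirror l).measurable).measurableEmbedding

lemma norm_mirror_sub_mirror {m : ℕ} (l : ℝ) (x y : E (m + 1)) :
    ‖mirror l x - mirror l y‖ = ‖x - y‖ := by
  simp only [mirror, add_sub_add_right_eq_sub, ← map_sub, LinearIsometryEquiv.norm_map]

lemma norm_sq_eq_add {m : ℕ} (x : E (m + 1)) : ‖x‖ ^ 2 = ‖horiz x‖ ^ 2 + height x ^ 2 := by
  simp only [EuclideanSpace.norm_sq_eq, Fin.sum_univ_castSucc, horiz, height, Real.norm_eq_abs,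
    sq_abs]

lemma horiz_sub {m : ℕ} (x y : E (m + 1)) : horiz (x - y) = horiz x - horiz y := rfl

lemma height_sub {m : ℕ} (x y : E (m + 1)) : height (x - y) = height x - height y := rfl

lemma abs_height_le {m : ℕ} (x : E (m + 1)) : |height x| ≤ ‖x‖ :=
  abs_le_of_sq_le_sq (by nlinarith [norm_sq_eq_add x, sq_nonneg ‖horiz x‖]) (norm_nonneg _)

lemma norm_horiz_le {m : ℕ} (x : E (m + 1)) : ‖horiz x‖ ≤ ‖x‖ :=
  le_of_sq_le_sq (by nlinarith [norm_sq_eq_add x, sq_nonneg (height x)]) (norm_nonneg _)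

lemma norm_le_add {m : ℕ} (x : E (m + 1)) : ‖x‖ ≤ ‖horiz x‖ + |height x| :=
  le_of_sq_le_sq (by
    nlinarith [norm_sq_eq_add x, sq_abs (height x), norm_nonneg (horiz x), abs_nonneg (height x),
      mul_nonneg (norm_nonneg (horiz x)) (abs_nonneg (height x))]) (by positivity)

lemma norm_sub_mirror_sq {m : ℕ} (l : ℝ) (x y : E (m + 1)) :
    ‖x - mirror l y‖ ^ 2 = ‖x - y‖ ^ 2 + 4 * (l - height x) * (l - height y) := by
  simp only [norm_sq_eq_add, horiz_sub, height_sub, horiz_mirror, height_mirror]; ring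

/-- On the near side of the hyperplane a point is closer than its mirror image. -/
lemma norm_sub_lt_norm_sub_mirror {m : ℕ} {l : ℝ} {x y : E (m + 1)} (hx : height x < l)
    (hy : height y < l) : ‖x - y‖ < ‖x - mirror l y‖ :=
  lt_of_pow_lt_pow_left₀ 2 (norm_nonneg _) (by
    rw [norm_sub_mirror_sq]; nlinarith [mul_pos (sub_pos.2 hx) (sub_pos.2 hy)])

lemma le_norm_sub_mirror {m : ℕ} {l : ℝ} {x y : E (m + 1)} (hy : height y ≤ l) :
    l - height x ≤ ‖x - mirror l y‖ := by
  have := (neg_abs_le _).trans' (neg_le_neg (abs_height_le (x - mirror l y)))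
  rw [height_sub, height_mirror] at this
  linarith

lemma kernel_mirror_lt {m : ℕ} {l : ℝ} {x y : E (m + 1)} (hx : height x < l)
    (hy : height y < l) (hxy : x ≠ y) : kernel x (mirror l y) < kernel x y := by
  have := norm_sub_lt_norm_sub_mirror hx hy
  have h0 : 0 < ‖x - y‖ := norm_pos_iff.2 (sub_ne_zero.2 hxy)
  unfold kernel
  gcongr

lemma continuous_height {m : ℕ} : Continuous (height : E (m + 1) → ℝ) := by
  unfold height; fun_prop

lemma continuous_horiz {m : ℕ} : Continuous (horiz : E (m + 1) → E m) := by
  unfold horiz; fun_prop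

lemma volume_hyperplane {m : ℕ} (l : ℝ) : volume {x : E (m + 1) | height x = l} = 0 := by
  set p : Submodule ℝ (E (m + 1)) := LinearMap.ker (EuclideanSpace.proj (Fin.last m) :
    E (m + 1) →L[ℝ] ℝ).toLinearMap with hp
  have h0 : volume (p : Set (E (m + 1))) = 0 := by
    refine Measure.addHaar_submodule _ _ fun h => ?_
    have : EuclideanSpace.single (Fin.last m) (1 : ℝ) ∈ p := h ▸ Submodule.mem_top
    simp [hp] at this
  rw [← measure_preimage_add_right volume (EuclideanSpace.single (Fin.last m) (-l))] at h0
  convert h0 using 2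
  ext x
  simp [hp, height, add_neg_eq_zero]

/-! ### The logarithmic Laplacian of antisymmetric functions -/

lemma integrand_eq {n : ℕ} (u : E n → ℝ) (x y : E n) :
    integrand u x y = (Metric.ball x 1).indicator (fun _ => u x) y * kernel x y
      + -(u y * kernel x y) := by
  simp only [integrand, kernel, div_eq_mul_inv]; ring

lemma HasLogLaplacianAt.sub {n : ℕ} {u v : E n → ℝ} {x : E n} {b c : ℝ}
    (hu : HasLogLaplacianAt u x b) (hv : HasLogLaplacianAt v x c) :
    HasLogLaplacianAt (fun y => u y - v y) x (b - c) := by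
  have key : integrand (fun y => u y - v y) x = fun y => integrand u x y - integrand v x y := by
    ext y
    simp only [integrand_eq]
    by_cases hy : y ∈ Metric.ball x 1 <;> simp only [hy, indicator_of_mem, indicator_of_notMem,
      not_false_eq_true] <;> ring
  refine ⟨fun ε hε => ?_, ?_⟩
  · rw [key]; exact (hu.1 ε hε).sub (hv.1 ε hε)
  · refine (hu.2.sub hv.2).congr' ?_
    filter_upwards [self_mem_nhdsWithin] with ε hε
    rw [key, integral_sub (hu.1 ε hε) (hv.1 ε hε)]
    ring

/-- The logarithmic Laplacian commutes with reflections. -/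
lemma HasLogLaplacianAt.comp_mirror {m : ℕ} {u : E (m + 1) → ℝ} {x : E (m + 1)} {b l : ℝ}
    (hu : HasLogLaplacianAt u (mirror l x) b) :
    HasLogLaplacianAt (fun y => u (mirror l y)) x b := by
  have key : integrand (fun y => u (mirror l y)) x
      = fun y => integrand u (mirror l x) (mirror l y) := by
    ext y
    simp only [integrand, norm_mirror_sub_mirror, indicator, mem_ball_iff_norm_sub]
  have hball (ε : ℝ) : (Metric.closedBall x ε)ᶜ
      = mirror l ⁻¹' (Metric.closedBall (mirror l x) ε)ᶜ := by
    ext y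
    rw [mem_preimage, mem_compl_closedBall, mem_compl_closedBall, norm_mirror_sub_mirror]
  refine ⟨fun ε hε => ?_, hu.2.congr fun ε => ?_⟩
  · rw [key, hball]
    exact ((measurePreserving_mirror l).integrableOn_comp_preimage
      (measurableEmbedding_mirror l)).2 (hu.1 ε hε)
  · rw [key, hball, (measurePreserving_mirror l).setIntegral_preimage_emb
      (measurableEmbedding_mirror l)]

/-- Integrals can be compared after symmetrization under a reflection. -/
lemma integral_le_of_add_mirror_le {m : ℕ} {l : ℝ} {g h : E (m + 1) → ℝ} (hg : Integrable g)
    (hh : Integrable h)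
    (hgh : ∀ y, height y ≤ l → g y + g (mirror l y) ≤ h y + h (mirror l y)) :
    ∫ y, g y ≤ ∫ y, h y := by
  have hall (y : E (m + 1)) : g y + g (mirror l y) ≤ h y + h (mirror l y) := by
    rcases le_or_gt (height y) l with hy | hy
    · exact hgh y hy
    · have := hgh (mirror l y) (by rw [height_mirror]; linarith)
      rw [mirror_mirror] at this
      linarith
  have hmp := measurePreserving_mirror (m := m) l
  have hemb := measurableEmbedding_mirror (m := m) l
  have hg' : Integrable fun y => g (mirror l y) := (hmp.integrable_comp_emb hemb).2 hg
  have hh' : Integrable fun y => h (mirror l y) := (hmp.integrable_comp_emb hemb).2 hh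
  have := integral_mono (hg.add hg') (hh.add hh') hall
  simp only [Pi.add_apply] at this
  rw [integral_add hg hg', integral_add hh hh', hmp.integral_comp hemb,
    hmp.integral_comp hemb] at this
  linarith

/-- For an antisymmetric `w` the integral of `-w(y) |x - y|^{-n}` over the complement of a small
ball is controlled by the half space alone, where the kernel may be replaced by the difference
`|x - y|^{-n} - |x - y^λ|^{-n}`. The last term accounts for the mirror image of the ball, which is
not removed from the domain of integration. -/
lemma setIntegral_neg_mul_kernel_le {m : ℕ} {l : ℝ} {x : E (m + 1)} (hx : height x < l)
    {w h : E (m + 1) → ℝ} {B ε : ℝ} (hanti : ∀ y, w (mirror l y) = -w y) (hB : ∀ y, |w y| ≤ B)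
    (hε : ε < l - height x)
    (hw : IntegrableOn (fun y => w y * kernel x y) (Metric.closedBall x ε)ᶜ)
    (hle : ∀ y, height y < l → y ≠ x → -(w y * (kernel x y - kernel x (mirror l y))) ≤ h y)
    (h0 : ∀ y, l ≤ height y → 0 ≤ h y) (hh : IntegrableOn h (Metric.closedBall x ε)ᶜ)
    (hε0 : 0 < ε) :
    ∫ y in (Metric.closedBall x ε)ᶜ, -(w y * kernel x y) ≤
      (∫ y in (Metric.closedBall x ε)ᶜ, h y)
        + B * ((l - height x) ^ (m + 1))⁻¹ * volume.real (Metric.closedBall x ε) := by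
  set D := B * ((l - height x) ^ (m + 1))⁻¹ with hD
  have hm : MeasurableSet (Metric.closedBall x ε) := Metric.isClosed_closedBall.measurableSet
  have hB0 : 0 ≤ B := (abs_nonneg _).trans (hB x)
  have hD0 : 0 ≤ D := by
    have := sub_pos.2 hx
    positivity
  have hconst : Integrable ((Metric.closedBall x ε).indicator fun _ => D) :=
    (integrable_indicator_iff hm).2 (integrableOn_const (measure_closedBall_lt_top.ne))
  have hh' : Integrable ((Metric.closedBall x ε)ᶜ.indicator h) :=
    (integrable_indicator_iff hm.compl).2 hh
  have hw' : Integrable ((Metric.closedBall x ε)ᶜ.indicator fun y => -(w y * kernel x y)) :=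
    (integrable_indicator_iff hm.compl).2 hw.neg
  have hsum : (∫ y in (Metric.closedBall x ε)ᶜ, h y) + D * volume.real (Metric.closedBall x ε)
      = ∫ y, ((Metric.closedBall x ε)ᶜ.indicator h y
        + (Metric.closedBall x ε).indicator (fun _ => D) y) := by
    rw [integral_add hh' hconst, integral_indicator hm.compl, integral_indicator hm,
      setIntegral_const, smul_eq_mul, mul_comm D]
  rw [hsum, ← integral_indicator hm.compl]
  refine integral_le_of_add_mirror_le (l := l) hw' (hh'.add hconst) fun y hy => ?_
  rcases hy.lt_or_eq with hy | hy
  · have hfar : mirror l y ∈ (Metric.closedBall x ε)ᶜ :=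
      mem_compl_closedBall.2 (hε.trans_le (le_norm_sub_mirror hy.le))
    have hfar' : mirror l y ∉ Metric.closedBall x ε := hfar
    have hpos := h0 (mirror l y) (by rw [height_mirror]; linarith)
    have hk : kernel x (mirror l y) ≤ ((l - height x) ^ (m + 1))⁻¹ :=
      kernel_le (sub_pos.2 hx) (le_norm_sub_mirror hy.le)
    simp only [indicator_of_mem hfar, indicator_of_notMem hfar', hanti]
    by_cases hyB : y ∈ Metric.closedBall x ε
    · have : w y * kernel x (mirror l y) ≤ D :=
        mul_le_mul ((le_abs_self _).trans (hB y)) hk (kernel_nonneg _ _) hB0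
      simp only [indicator_of_mem hyB, indicator_of_notMem (notMem_compl_iff.2 hyB)]
      linarith
    · have hne : y ≠ x := by
        rintro rfl
        exact hyB (Metric.mem_closedBall_self hε0.le)
      have := hle y hy hne
      simp only [indicator_of_notMem hyB, indicator_of_mem (mem_compl hyB)]
      linarith
  · have hfix : mirror l y = y := ext_horiz_height (by simp) (by rw [height_mirror]; linarith)
    have hwy : w y = 0 := by
      have := hanti y
      rw [hfix] at this
      linarith
    have hpos := h0 y hy.ge
    have h1 : 0 ≤ (Metric.closedBall x ε)ᶜ.indicator h y := indicator_apply_nonneg fun _ => hpos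
    have h2 : 0 ≤ (Metric.closedBall x ε).indicator (fun _ => D) y :=
      indicator_nonneg (fun _ _ => hD0) y
    have h3 : (Metric.closedBall x ε)ᶜ.indicator (fun y => -(w y * kernel x y)) y = 0 := by
      simp [hwy]
    simp only [hfix, h3]
    linarith

lemma tendsto_volume_closedBall {m : ℕ} (x : E (m + 1)) :
    Tendsto (fun ε : ℝ => volume.real (Metric.closedBall x ε)) (𝓝[>] 0) (𝓝 0) := by
  have h : Tendsto (fun ε : ℝ => ε ^ (m + 1) * volume.real (Metric.ball (0 : E (m + 1)) 1))
      (𝓝[>] 0) (𝓝 0) := by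
    have : Continuous fun ε : ℝ => ε ^ (m + 1) * volume.real (Metric.ball (0 : E (m + 1)) 1) := by
      fun_prop
    simpa using (this.tendsto 0).mono_left nhdsWithin_le_nhds
  refine h.congr' ?_
  filter_upwards [self_mem_nhdsWithin] with ε hε
  rw [Measure.addHaar_real_closedBall _ _ (le_of_lt hε), finrank_euclideanSpace, Fintype.card_fin]

lemma integrableOn_indicator_ball_mul_kernel {m : ℕ} (x : E (m + 1)) (c : ℝ) {ε : ℝ}
    (hε : 0 < ε) : IntegrableOn (fun y => (Metric.ball x 1).indicator (fun _ => c) y * kernel x y)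
      (Metric.closedBall x ε)ᶜ := by
  have h : (fun y => (Metric.ball x 1).indicator (fun _ => c) y * kernel x y)
      = (Metric.ball x 1).indicator fun y => c * kernel x y := by
    ext y; by_cases hy : y ∈ Metric.ball x 1 <;> simp [hy]
  rw [h, IntegrableOn, integrable_indicator_iff measurableSet_ball, IntegrableOn,
    Measure.restrict_restrict measurableSet_ball]
  refine Integrable.const_mul (integrableOn_kernel x hε
    (measurableSet_ball.inter Metric.isClosed_closedBall.measurableSet.compl)
    ((measure_mono inter_subset_left).trans_lt measure_ball_lt_top).ne
    fun y hy => (mem_compl_closedBall.1 hy.2).le) c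

/-- An upper bound for the logarithmic Laplacian of an antisymmetric function that only involves
its values in the half space `x_n < λ`. -/
lemma HasLogLaplacianAt.le_of_antisymm {m : ℕ} {l : ℝ} {x : E (m + 1)} (hx : height x < l)
    {w h : E (m + 1) → ℝ} {B v Q : ℝ} (hv : HasLogLaplacianAt w x v)
    (hanti : ∀ y, w (mirror l y) = -w y) (hB : ∀ y, |w y| ≤ B)
    (hle : ∀ y, height y < l → y ≠ x → -(w y * (kernel x y - kernel x (mirror l y))) ≤ h y)
    (h0 : ∀ y, l ≤ height y → 0 ≤ h y)
    (hh : ∀ ε > 0, IntegrableOn h (Metric.closedBall x ε)ᶜ)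
    (hQ : ∀ᶠ ε : ℝ in 𝓝[>] 0, ∫ y in (Metric.closedBall x ε)ᶜ,
      ((Metric.ball x 1).indicator (fun _ => w x) y * kernel x y + h y) ≤ Q) :
    v ≤ constC (m + 1) * Q + constRho (m + 1) * w x := by
  set D := B * ((l - height x) ^ (m + 1))⁻¹ with hD
  have hlim : Tendsto (fun ε : ℝ => constC (m + 1) * (Q + D * volume.real
      (Metric.closedBall x ε)) + constRho (m + 1) * w x) (𝓝[>] 0)
      (𝓝 (constC (m + 1) * (Q + D * 0) + constRho (m + 1) * w x)) :=
    ((((tendsto_volume_closedBall x).const_mul D).const_add Q).const_mul _).add_const _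
  rw [mul_zero, add_zero] at hlim
  refine le_of_tendsto_of_tendsto hv.2 hlim ?_
  have hsmall : ∀ᶠ ε : ℝ in 𝓝[>] 0, ε < l - height x :=
    nhdsWithin_le_nhds (Iio_mem_nhds (sub_pos.2 hx))
  filter_upwards [hQ, hsmall, self_mem_nhdsWithin] with ε hεQ hεl hε
  have hball := integrableOn_indicator_ball_mul_kernel x (w x) (mem_Ioi.1 hε)
  have hwk : IntegrableOn (fun y => w y * kernel x y) (Metric.closedBall x ε)ᶜ := by
    refine (hball.sub (hv.1 ε hε)).congr (Eventually.of_forall fun y => ?_)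
    simp only [Pi.sub_apply, integrand_eq]; ring
  have hmain := setIntegral_neg_mul_kernel_le hx hanti hB hεl hwk hle h0 (hh ε hε) hε
  have heq : ∫ y in (Metric.closedBall x ε)ᶜ, integrand w x y
      = (∫ y in (Metric.closedBall x ε)ᶜ,
        (Metric.ball x 1).indicator (fun _ => w x) y * kernel x y)
        + ∫ y in (Metric.closedBall x ε)ᶜ, -(w y * kernel x y) := by
    rw [integral_congr_ae (Eventually.of_forall (integrand_eq w x))]
    exact integral_add hball hwk.neg
  have hadd := integral_add hball (hh ε hε)
  have := (constC_pos m).le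
  have hsum : ∫ y in (Metric.closedBall x ε)ᶜ, integrand w x y
      ≤ Q + D * volume.real (Metric.closedBall x ε) := by
    rw [heq]
    linarith [hadd.symm.trans_le hεQ]
  gcongr

/-- The maximum principle for small negativity sets: an antisymmetric function cannot have a
negative minimum over the half space at a point where its logarithmic Laplacian is nonnegative,
provided the volume of the set where it is negative is below a universal threshold. -/
lemma exists_volume_threshold (m : ℕ) : ∃ δ : ℝ, 0 < δ ∧ ∀ (l B v : ℝ) (x : E (m + 1))
    (w : E (m + 1) → ℝ), Continuous w → (∀ y, w (mirror l y) = -w y) → (∀ y, |w y| ≤ B) →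
    height x < l → w x < 0 → (∀ y, height y < l → w x ≤ w y) →
    volume {y | height y < l ∧ w y < 0} ≤ ENNReal.ofReal δ → HasLogLaplacianAt w x v → v < 0 := by
  set C := constC (m + 1) with hC
  set σ := sphereArea (m + 1) with hσ
  set ρ := constRho (m + 1) with hρ
  have hC0 : 0 < C := constC_pos m
  have hσ0 : 0 < σ := sphereArea_pos m
  -- The radius is chosen so that `C σ ln (1 / r) = |ρ| + 2 C`.
  set r := Real.exp (-((|ρ| + 2 * C) / (C * σ))) with hr
  have hr0 : 0 < r := Real.exp_pos _
  have hr1 : r ≤ 1 := Real.exp_le_one_iff.2 (by rw [neg_nonpos]; positivity)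
  have hlog : C * (σ * Real.log (1 / r)) = |ρ| + 2 * C := by
    rw [one_div, Real.log_inv, hr, Real.log_exp]; field_simp
  set q := 1 + (r ^ (m + 1))⁻¹ with hq
  have hq0 : 0 < q := by positivity
  refine ⟨q⁻¹, by positivity, fun l B v x w hw hanti hB hx hwx hmin hvol hv => ?_⟩
  set N := {y | height y < l ∧ w y < 0} with hN
  have hNm : MeasurableSet N :=
    ((isOpen_Iio.preimage continuous_height).inter (isOpen_Iio.preimage hw)).measurableSet
  have hNfin : volume N ≠ ⊤ := (hvol.trans_lt ENNReal.ofReal_lt_top).ne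
  have hNr : volume.real N ≤ q⁻¹ := ENNReal.toReal_le_of_le_ofReal (by positivity) hvol
  have hM : 0 < -w x := neg_pos.2 hwx
  have hNint : ∀ ε > 0, IntegrableOn (N.indicator fun y => -w x * kernel x y)
      (Metric.closedBall x ε)ᶜ := fun ε hε => by
    rw [IntegrableOn, integrable_indicator_iff hNm, IntegrableOn, Measure.restrict_restrict hNm]
    exact Integrable.const_mul (integrableOn_kernel x hε
      (hNm.inter Metric.isClosed_closedBall.measurableSet.compl)
      ((measure_mono inter_subset_left).trans_lt hNfin.lt_top).ne
      fun y hy => (mem_compl_closedBall.1 hy.2).le) _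
  have hbound := hv.le_of_antisymm (h := N.indicator fun y => -w x * kernel x y)
    (Q := -w x * (q * volume.real N - σ * Real.log (1 / r))) hx hanti hB ?_ ?_ hNint ?_
  · have h1 : C * (q * volume.real N) ≤ C := by
      have : q * volume.real N ≤ 1 := by
        calc q * volume.real N ≤ q * q⁻¹ := by gcongr
          _ = 1 := mul_inv_cancel₀ hq0.ne'
      nlinarith
    have h2 : -ρ ≤ |ρ| := neg_le_abs ρ
    have h3 : v ≤ -w x * (C * (q * volume.real N) - C * (σ * Real.log (1 / r)) - ρ) := by
      linarith
    refine h3.trans_lt (mul_neg_of_pos_of_neg hM ?_)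
    rw [hlog]
    linarith
  · intro y hy hyx
    have hk := kernel_mirror_lt hx hy hyx.symm
    have hk0 := kernel_nonneg x (mirror l y)
    by_cases hyN : y ∈ N
    · rw [indicator_of_mem hyN]
      have h1 := hmin y hy
      have h2 := hyN.2
      nlinarith
    · rw [indicator_of_notMem hyN]
      have h1 : 0 ≤ w y := by
        by_contra hneg
        exact hyN ⟨hy, not_le.1 hneg⟩
      nlinarith
  · intro y _
    exact indicator_nonneg (fun z _ => mul_nonneg hM.le (kernel_nonneg _ _)) y
  · have hann : IntegrableOn (kernel x) (annulus x r 1) :=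
      integrableOn_kernel x hr0 (measurableSet_annulus x r 1)
        ((measure_mono (annulus_subset_ball x r 1)).trans_lt measure_ball_lt_top).ne
        fun y hy => hy.1.le
    have hI1 : Integrable (N.indicator fun _ => q) :=
      (integrable_indicator_iff hNm).2 (integrableOn_const hNfin)
    have hI2 : Integrable ((annulus x r 1).indicator (kernel x)) :=
      (integrable_indicator_iff (measurableSet_annulus x r 1)).2 hann
    have hsm : ∀ᶠ ε : ℝ in 𝓝[>] 0, ε < r := nhdsWithin_le_nhds (Iio_mem_nhds hr0)
    filter_upwards [hsm, self_mem_nhdsWithin] with ε hεr hε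
    have hε' : 0 < ε := hε
    have hsub : annulus x r 1 ⊆ (Metric.closedBall x ε)ᶜ := fun y hy =>
      mem_compl_closedBall.2 (hεr.trans hy.1)
    calc ∫ y in (Metric.closedBall x ε)ᶜ,
        ((Metric.ball x 1).indicator (fun _ => w x) y * kernel x y
          + N.indicator (fun y => -w x * kernel x y) y)
        ≤ ∫ y in (Metric.closedBall x ε)ᶜ,
          -w x * (N.indicator (fun _ => q) y - (annulus x r 1).indicator (kernel x) y) := by
          refine integral_mono
            ((integrableOn_indicator_ball_mul_kernel x (w x) hε).add (hNint ε hε))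
            (((hI1.sub hI2).const_mul _).integrableOn) fun y => ?_
          have hk := kernel_nonneg x y
          have hq1 : 1 ≤ q := by rw [hq]; simp; positivity
          -- On the part of `N` in the unit ball the two terms on the left cancel; outside the
          -- annulus of inner radius `r` the kernel is at most `q`.
          have hfar : r ≤ ‖x - y‖ → kernel x y ≤ q := fun h =>
            (kernel_le hr0 h).trans (by rw [hq]; linarith)
          have hfar1 : 1 ≤ ‖x - y‖ → kernel x y ≤ q := fun h => hfar (hr1.trans h)
          have hannd : y ∈ annulus x r 1 ↔ r < ‖x - y‖ ∧ ‖x - y‖ < 1 := Iff.rfl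
          simp only [indicator, mem_ball_iff_norm_sub, hannd]
          by_cases h1 : ‖x - y‖ < 1 <;> by_cases h2 : y ∈ N <;> by_cases h3 : r < ‖x - y‖ <;>
            simp only [h1, h2, h3, and_self, and_true, and_false, if_true, if_false]
          all_goals first
            | nlinarith [hfar h3.le]
            | nlinarith [hfar1 (not_lt.1 h1)]
            | nlinarith
      _ = -w x * (q * volume.real (N ∩ (Metric.closedBall x ε)ᶜ) - σ * Real.log (1 / r)) := by
          rw [integral_const_mul, integral_sub hI1.integrableOn hI2.integrableOn,
            setIntegral_indicator (measurableSet_annulus x r 1), inter_eq_right.2 hsub,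
            integral_annulus_kernel x hr0 hr1, setIntegral_indicator hNm, setIntegral_const,
            smul_eq_mul, inter_comm, mul_comm q]
      _ ≤ -w x * (q * volume.real N - σ * Real.log (1 / r)) := by
          have : volume.real (N ∩ (Metric.closedBall x ε)ᶜ) ≤ volume.real N :=
            measureReal_mono inter_subset_left hNfin
          gcongr

/-- The strong maximum principle for antisymmetric functions that are nonnegative on the near side
of the hyperplane. -/
lemma HasLogLaplacianAt.neg_of_antisymm {m : ℕ} {l B v : ℝ} {x y₀ : E (m + 1)}
    {w : E (m + 1) → ℝ} (hv : HasLogLaplacianAt w x v) (hw : Continuous w)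
    (hanti : ∀ y, w (mirror l y) = -w y) (hB : ∀ y, |w y| ≤ B) (hx : height x < l) (hwx : w x = 0)
    (hpos : ∀ y, height y < l → 0 ≤ w y) (hy₀ : height y₀ < l) (hwy₀ : 0 < w y₀) : v < 0 := by
  have hne : x ≠ y₀ := by rintro rfl; exact hwy₀.ne' hwx
  have hd : 0 < ‖x - y₀‖ := norm_pos_iff.2 (sub_ne_zero.2 hne)
  set g : E (m + 1) → ℝ := fun y => w y * (kernel x y - kernel x (mirror l y)) with hg
  have hg0 : 0 < g y₀ := mul_pos hwy₀ (sub_pos.2 (kernel_mirror_lt hx hy₀ hne))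
  have hgc : ContinuousAt g y₀ := by
    have h1 : ContinuousAt (kernel x) y₀ := by
      unfold kernel
      exact ContinuousAt.inv₀ (by fun_prop) (pow_pos hd _).ne'
    have h2 : ContinuousAt (fun y => kernel x (mirror l y)) y₀ := by
      unfold kernel
      refine ContinuousAt.inv₀ ?_ (pow_pos (hd.trans (norm_sub_lt_norm_sub_mirror hx hy₀)) _).ne'
      exact ((continuous_const.sub (continuous_mirror l)).norm.pow _).continuousAt
    exact hw.continuousAt.mul (h1.sub h2)
  obtain ⟨s, hs, hball⟩ := Metric.eventually_nhds_iff_ball.1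
    ((hgc.eventually (lt_mem_nhds (half_lt_self hg0))).and
      ((continuous_height.continuousAt.eventually (gt_mem_nhds hy₀)).and
        ((by fun_prop : Continuous fun y => ‖x - y‖).continuousAt.eventually
          (lt_mem_nhds (half_lt_self hd)))))
  set c := g y₀ / 2 with hc
  have hc0 : 0 < c := half_pos hg0
  have hAvol : 0 < volume.real (Metric.ball y₀ s) :=
    ENNReal.toReal_pos (Metric.measure_ball_pos _ _ hs).ne' measure_ball_lt_top.ne
  have hint : Integrable ((Metric.ball y₀ s).indicator fun _ => -c) :=
    (integrable_indicator_iff measurableSet_ball).2 (integrableOn_const measure_ball_lt_top.ne)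
  have hbound := hv.le_of_antisymm (h := (Metric.ball y₀ s).indicator fun _ => -c)
    (Q := -c * volume.real (Metric.ball y₀ s)) hx hanti hB ?_ ?_ (fun ε _ => hint.integrableOn) ?_
  · rw [hwx, mul_zero, add_zero] at hbound
    refine hbound.trans_lt (mul_neg_of_pos_of_neg (constC_pos m) ?_)
    exact mul_neg_of_neg_of_pos (neg_neg_of_pos hc0) hAvol
  · intro y hy hyx
    by_cases hyA : y ∈ Metric.ball y₀ s
    · rw [indicator_of_mem hyA]
      exact neg_le_neg (hball y hyA).1.le
    · rw [indicator_of_notMem hyA]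
      exact neg_nonpos.2 (mul_nonneg (hpos y hy)
        (sub_nonneg.2 (kernel_mirror_lt hx hy hyx.symm).le))
  · intro y hy
    rw [indicator_of_notMem]
    exact fun hyA => absurd (hball y hyA).2.1 (not_lt.2 hy)
  · have hsm : ∀ᶠ ε : ℝ in 𝓝[>] 0, ε < ‖x - y₀‖ / 2 :=
      nhdsWithin_le_nhds (Iio_mem_nhds (half_pos hd))
    filter_upwards [hsm] with ε hε
    have hsub : Metric.ball y₀ s ⊆ (Metric.closedBall x ε)ᶜ := fun y hy =>
      mem_compl_closedBall.2 (hε.trans (hball y hy).2.2)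
    simp only [hwx, indicator_zero, zero_mul, zero_add]
    rw [setIntegral_indicator measurableSet_ball, inter_eq_right.2 hsub, setIntegral_const,
      smul_eq_mul, mul_comm]

/-! ### A compactly supported strict subsolution -/

/-- The tent function `y ↦ (1 - |z - y| / R)₊` of height `1` over the ball `B_R(z)`. -/
noncomputable def tent {n : ℕ} (R : ℝ) (z y : E n) : ℝ := max 0 (1 - ‖z - y‖ / R)

lemma tent_nonneg {n : ℕ} (R : ℝ) (z y : E n) : 0 ≤ tent R z y := le_max_left _ _

lemma tent_le_one {n : ℕ} {R : ℝ} (hR : 0 < R) (z y : E n) : tent R z y ≤ 1 :=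
  max_le zero_le_one (by have := div_nonneg (norm_nonneg (z - y)) hR.le; linarith)

lemma continuous_tent {n : ℕ} (R : ℝ) (z : E n) : Continuous (tent R z) := by
  unfold tent; fun_prop

lemma tent_eq_zero {n : ℕ} {R : ℝ} (hR : 0 < R) {z y : E n} (h : R ≤ ‖z - y‖) :
    tent R z y = 0 :=
  max_eq_left (by rw [sub_nonpos]; exact (one_le_div hR).2 h)

lemma tent_sub_le {n : ℕ} {R : ℝ} (hR : 0 < R) (z x y : E n) :
    tent R z x - ‖x - y‖ / R ≤ tent R z y := by
  have h1 : ‖z - y‖ ≤ ‖z - x‖ + ‖x - y‖ := norm_sub_le_norm_sub_add_norm_sub _ _ _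
  have h2 : ‖z - y‖ / R ≤ ‖z - x‖ / R + ‖x - y‖ / R := by rw [← add_div]; gcongr
  have h3 : 0 ≤ ‖x - y‖ / R := by positivity
  rw [sub_le_iff_le_add]
  refine max_le (add_nonneg (tent_nonneg R z y) h3) ?_
  have := le_max_right 0 (1 - ‖z - y‖ / R)
  unfold tent
  linarith

lemma integrable_tent {n : ℕ} {R : ℝ} (hR : 0 < R) (z : E n) : Integrable (tent R z) :=
  (continuous_tent R z).integrable_of_hasCompactSupport
    (HasCompactSupport.intro (isCompact_closedBall z R) fun _ hy =>
      tent_eq_zero hR (mem_compl_closedBall.1 hy).le)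

lemma integrableOn_integrand_tent {m : ℕ} {R ε : ℝ} (hR : 0 < R) (hε : 0 < ε)
    (z x : E (m + 1)) :
    IntegrableOn (integrand (tent R z) x) (Metric.closedBall x ε)ᶜ := by
  have h : IntegrableOn (fun y => tent R z y * kernel x y) (Metric.closedBall x ε)ᶜ := by
    refine Integrable.mono' ((integrable_tent hR z).integrableOn.mul_const (ε ^ (m + 1))⁻¹)
      (((continuous_tent R z).measurable.mul (measurable_kernel x)).aestronglyMeasurable)
      ((ae_restrict_iff' Metric.isClosed_closedBall.measurableSet.compl).2
        (Eventually.of_forall fun y hy => ?_))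
    rw [Real.norm_of_nonneg (mul_nonneg (tent_nonneg R z y) (kernel_nonneg x y))]
    exact mul_le_mul_of_nonneg_left (kernel_le hε (mem_compl_closedBall.1 hy).le)
      (tent_nonneg R z y)
  exact ((integrableOn_indicator_ball_mul_kernel x (tent R z x) hε).add h.neg).congr
    (Eventually.of_forall fun y => (integrand_eq _ x y).symm)

/-- The Lipschitz bound controls the integrand inside the unit ball; outside, only the negative
contribution of a region `A` where the tent function is at least `β` is kept. -/
lemma setIntegral_integrand_tent_le {m : ℕ} {R ε β : ℝ} (hR : 0 < R) (hε : 0 < ε) (hε1 : ε < 1)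
    (z x : E (m + 1)) {A : Set (E (m + 1))} (hA : MeasurableSet A) (hAfin : volume A ≠ ⊤)
    (hA1 : ∀ y ∈ A, 1 < ‖x - y‖) (hβ : ∀ y ∈ A, β ≤ tent R z y) :
    ∫ y in (Metric.closedBall x ε)ᶜ, integrand (tent R z) x y
      ≤ sphereArea (m + 1) / R - β * ∫ y in A, kernel x y := by
  have hAint : IntegrableOn (kernel x) A :=
    integrableOn_kernel x one_pos hA hAfin fun y hy => (hA1 y hy).le
  have hann := measurableSet_annulus x ε 1
  have hNint : IntegrableOn (fun y => ‖x - y‖ * kernel x y) (annulus x ε 1) := by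
    refine integrableOn_of_le (C := (ε ^ (m + 1))⁻¹)
      ((by fun_prop : Measurable fun y => ‖x - y‖).mul (measurable_kernel x)) hann
      ((measure_mono (annulus_subset_ball x ε 1)).trans_lt measure_ball_lt_top).ne fun y hy => ?_
    rw [abs_of_nonneg (mul_nonneg (norm_nonneg _) (kernel_nonneg x y))]
    calc ‖x - y‖ * kernel x y ≤ 1 * kernel x y :=
          mul_le_mul_of_nonneg_right hy.2.le (kernel_nonneg x y)
      _ ≤ (ε ^ (m + 1))⁻¹ := by rw [one_mul]; exact kernel_le hε hy.1.le
  have hI1 : Integrable (A.indicator (kernel x)) := (integrable_indicator_iff hA).2 hAint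
  have hI2 : Integrable ((annulus x ε 1).indicator fun y => ‖x - y‖ * kernel x y) :=
    (integrable_indicator_iff hann).2 hNint
  have hsubA : A ⊆ (Metric.closedBall x ε)ᶜ := fun y hy =>
    mem_compl_closedBall.2 (hε1.trans (hA1 y hy))
  have hsubN : annulus x ε 1 ⊆ (Metric.closedBall x ε)ᶜ := fun y hy =>
    mem_compl_closedBall.2 hy.1
  calc ∫ y in (Metric.closedBall x ε)ᶜ, integrand (tent R z) x y
      ≤ ∫ y in (Metric.closedBall x ε)ᶜ,
        (R⁻¹ * (annulus x ε 1).indicator (fun y => ‖x - y‖ * kernel x y) y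
          - β * A.indicator (kernel x) y) := by
        refine setIntegral_mono_on (integrableOn_integrand_tent hR hε z x)
          ((hI2.const_mul _).sub (hI1.const_mul _)).integrableOn
          Metric.isClosed_closedBall.measurableSet.compl fun y hy => ?_
        have hεy := mem_compl_closedBall.1 hy
        have hk := kernel_nonneg x y
        have ht := tent_nonneg R z y
        rw [integrand_eq]
        by_cases h1 : ‖x - y‖ < 1
        · have hyA : y ∉ A := fun h => lt_asymm h1 (hA1 y h)
          have hyN : y ∈ annulus x ε 1 := ⟨hεy, h1⟩
          rw [indicator_of_notMem hyA, indicator_of_mem hyN,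
            indicator_of_mem (mem_ball_iff_norm_sub.2 h1)]
          have := mul_le_mul_of_nonneg_right (tent_sub_le hR z x y) hk
          rw [div_eq_mul_inv] at this
          linarith
        · have hyN : y ∉ annulus x ε 1 := fun h => h1 h.2
          rw [indicator_of_notMem hyN,
            indicator_of_notMem fun h => h1 (mem_ball_iff_norm_sub.1 h)]
          by_cases hyA : y ∈ A
          · rw [indicator_of_mem hyA]
            have := mul_le_mul_of_nonneg_right (hβ y hyA) hk
            linarith
          · rw [indicator_of_notMem hyA]
            have := mul_nonneg ht hk
            linarith
    _ = R⁻¹ * (∫ y in annulus x ε 1, ‖x - y‖ * kernel x y) - β * ∫ y in A, kernel x y := by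
        rw [integral_sub (hI2.const_mul _).integrableOn (hI1.const_mul _).integrableOn,
          integral_const_mul, integral_const_mul, setIntegral_indicator hA,
          inter_eq_right.2 hsubA, setIntegral_indicator hann, inter_eq_right.2 hsubN]
    _ ≤ sphereArea (m + 1) / R - β * ∫ y in A, kernel x y := by
        rw [div_eq_inv_mul]
        have := integral_annulus_norm_mul_kernel_le x hε hε1.le
        gcongr

/-- Near the boundary of the support, the central part of the ball `B_R(z)` alone contributes an
amount that does not depend on `R`. -/
lemma le_setIntegral_kernel_ball_diff {m : ℕ} {R : ℝ} (hR : 4 ≤ R) {z x : E (m + 1)}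
    (hx : ‖z - x‖ < R) :
    volume.real (Metric.ball (0 : E (m + 1)) 1) * (4 ^ (m + 1))⁻¹ / 2
      ≤ ∫ y in Metric.ball z (R / 2) \ Metric.closedBall x 1, kernel x y := by
  set ω := volume.real (Metric.ball (0 : E (m + 1)) 1) with hω
  have hω0 : 0 ≤ ω := measureReal_nonneg
  set A := Metric.ball z (R / 2) \ Metric.closedBall x 1 with hA
  have hAm : MeasurableSet A := measurableSet_ball.diff Metric.isClosed_closedBall.measurableSet
  have hAfin : volume A ≠ ⊤ := ((measure_mono sdiff_subset).trans_lt measure_ball_lt_top).ne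
  have hR0 : 0 < R := by linarith
  have hvol : ω * (R / 2) ^ (m + 1) - ω ≤ volume.real A := by
    have h1 : volume.real (Metric.ball z (R / 2)) = (R / 2) ^ (m + 1) * ω := by
      rw [Measure.real, Measure.addHaar_ball _ _ (by positivity), finrank_euclideanSpace,
        Fintype.card_fin, ENNReal.toReal_mul, ENNReal.toReal_ofReal (by positivity)]
      rfl
    have h2 : volume.real (Metric.closedBall x 1) = ω := by
      rw [Measure.addHaar_real_closedBall _ _ zero_le_one, one_pow, one_mul]
    have h3 := le_measureReal_sdiff (μ := volume) (s₁ := Metric.ball z (R / 2))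
      (s₂ := Metric.closedBall x 1) measure_closedBall_lt_top.ne
    rw [h1, h2] at h3
    linarith
  have hlow : ((2 * R) ^ (m + 1))⁻¹ * volume.real A ≤ ∫ y in A, kernel x y := by
    rw [mul_comm, ← smul_eq_mul, ← setIntegral_const]
    refine setIntegral_mono_on (integrableOn_const hAfin)
      (integrableOn_kernel x one_pos hAm hAfin fun y hy => (mem_compl_closedBall.1 hy.2).le) hAm
      fun y hy => ?_
    have hne : x ≠ y := by
      rintro rfl
      exact hy.2 (Metric.mem_closedBall_self zero_le_one)
    refine le_kernel hne ?_
    have h1 : ‖x - y‖ ≤ ‖x - z‖ + ‖z - y‖ := norm_sub_le_norm_sub_add_norm_sub _ _ _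
    have h2 := mem_ball_iff_norm_sub.1 hy.1
    rw [norm_sub_rev x z] at h1
    linarith
  refine le_trans ?_ hlow
  have h4 : (R / 2) ^ (m + 1) = (4 ^ (m + 1))⁻¹ * (2 * R) ^ (m + 1) := by
    rw [← inv_pow, ← mul_pow]; congr 1; ring
  have h5 : (2 : ℝ) ≤ (R / 2) ^ (m + 1) := by
    calc (2 : ℝ) ≤ R / 2 := by linarith
      _ ≤ (R / 2) ^ (m + 1) := le_self_pow₀ (by linarith) (by omega)
  have h6 : ω * (R / 2) ^ (m + 1) / 2 ≤ volume.real A := by nlinarith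
  calc ω * (4 ^ (m + 1))⁻¹ / 2
      = ((2 * R) ^ (m + 1))⁻¹ * (ω * (R / 2) ^ (m + 1) / 2) := by
        rw [h4]; field_simp
    _ ≤ _ := by gcongr

/-- Over a sufficiently large ball the tent function is a strict subsolution, since its logarithmic
Laplacian picks up the term `-2 ln R` under dilation by `R`. -/
lemma exists_tent_subsolution (m : ℕ) : ∃ R : ℝ, 0 < R ∧ ∃ c < (0 : ℝ),
    ∀ z x : E (m + 1), ‖z - x‖ < R → ∀ ε : ℝ, 0 < ε → ε < 1 →
      constC (m + 1) * (∫ y in (Metric.closedBall x ε)ᶜ, integrand (tent R z) x y)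
        + constRho (m + 1) * tent R z x ≤ c := by
  set C := constC (m + 1) with hC
  set σ := sphereArea (m + 1) with hσ
  set ρ := constRho (m + 1) with hρ
  have hC0 : 0 < C := constC_pos m
  have hσ0 : 0 < σ := sphereArea_pos m
  set ω := volume.real (Metric.ball (0 : E (m + 1)) 1) with hω
  have hω0 : 0 < ω := ENNReal.toReal_pos (Metric.measure_ball_pos _ _ one_pos).ne'
    measure_ball_lt_top.ne
  set b := ω * (4 ^ (m + 1))⁻¹ / 4 with hb
  have hb0 : 0 < b := by positivity
  -- Below the height `η` the zeroth order term is dominated by the contribution of the central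
  -- part of the ball; above it, by the logarithmic divergence of the kernel at infinity.
  set η := C * b / (4 * (|ρ| + 1)) with hη
  have hη0 : 0 < η := by positivity
  have hηb : |ρ| * η ≤ C * b / 4 := by
    have h1 : η * (4 * (|ρ| + 1)) = C * b := div_mul_cancel₀ _ (by positivity)
    nlinarith
  have hlog : Tendsto (fun R : ℝ => η / 2 * (σ * Real.log (R * (η / 2)))) atTop atTop :=
    ((Real.tendsto_log_atTop.comp (tendsto_id.atTop_mul_const (half_pos hη0))).const_mul_atTop
      hσ0).const_mul_atTop (half_pos hη0)
  obtain ⟨R, h1, h2, h3, h4⟩ := ((eventually_ge_atTop (4 : ℝ)).and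
    ((eventually_ge_atTop (4 * σ / b)).and ((eventually_ge_atTop (2 / η)).and
      (hlog.eventually_ge_atTop (σ + (|ρ| + 1) / C))))).exists
  have hR0 : 0 < R := by linarith
  refine ⟨R, hR0, max (-(C * b / 2)) (-1), max_lt (by have := mul_pos hC0 hb0; linarith)
    (by norm_num), fun z x hx ε hε hε1 => ?_⟩
  have hp0 := tent_nonneg R z x
  have hρp : ρ * tent R z x ≤ |ρ| * tent R z x := by gcongr; exact le_abs_self ρ
  rcases le_or_gt (tent R z x) η with hp | hp
  · refine le_max_of_le_left ?_
    have hA := setIntegral_integrand_tent_le (β := 1 / 2) hR0 hε hε1 z x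
      (A := Metric.ball z (R / 2) \ Metric.closedBall x 1)
      (measurableSet_ball.diff Metric.isClosed_closedBall.measurableSet)
      ((measure_mono sdiff_subset).trans_lt measure_ball_lt_top).ne
      (fun y hy => mem_compl_closedBall.1 hy.2) (fun y hy => ?_)
    · have hlow := le_setIntegral_kernel_ball_diff h1 hx
      have hσR : σ / R ≤ b / 4 := by
        rw [div_le_iff₀ hb0] at h2
        rw [div_le_iff₀ hR0]
        linarith
      have hI : ∫ y in (Metric.closedBall x ε)ᶜ, integrand (tent R z) x y ≤ -(3 / 4 * b) := by
        linarith
      have hρη : |ρ| * tent R z x ≤ |ρ| * η := by gcongr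
      nlinarith
    · have hlt := mem_ball_iff_norm_sub.1 hy.1
      refine le_max_of_le_right ?_
      have : ‖z - y‖ / R ≤ 1 / 2 := by rw [div_le_iff₀ hR0]; linarith
      linarith
  · refine le_max_of_le_right ?_
    have hs : 1 ≤ R * (η / 2) := by
      rw [div_le_iff₀ hη0] at h3
      linarith
    have hA := setIntegral_integrand_tent_le (β := η / 2) hR0 hε hε1 z x
      (A := annulus x 1 (R * (η / 2))) (measurableSet_annulus _ _ _)
      ((measure_mono (annulus_subset_ball _ _ _)).trans_lt measure_ball_lt_top).ne
      (fun y hy => hy.1) (fun y hy => ?_)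
    · rw [integral_annulus_kernel x one_pos hs, div_one] at hA
      have hσR : σ / R ≤ σ := div_le_self hσ0.le (by linarith)
      have hI : ∫ y in (Metric.closedBall x ε)ᶜ, integrand (tent R z) x y ≤ -((|ρ| + 1) / C) := by
        linarith
      have hCI := mul_le_mul_of_nonneg_left hI hC0.le
      rw [mul_neg, mul_div_cancel₀ _ hC0.ne'] at hCI
      have hρ1 : |ρ| * tent R z x ≤ |ρ| * 1 := by gcongr; exact tent_le_one hR0 z x
      linarith
    · refine le_trans ?_ (tent_sub_le hR0 z x y)
      have : ‖x - y‖ / R ≤ η / 2 := by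
        rw [div_le_iff₀ hR0, mul_comm]; exact hy.2.le
      linarith

/-- A nonnegative function that is positive on a sufficiently large ball has negative logarithmic
Laplacian somewhere in that ball: slide a multiple of the tent function up until it touches the
function from below. -/
lemma exists_hasLogLaplacianAt_neg (m : ℕ) : ∃ R : ℝ, 0 < R ∧ ∀ (z : E (m + 1))
    (u : E (m + 1) → ℝ), Continuous u → (∀ y, 0 ≤ u y) →
    (∀ y ∈ Metric.closedBall z R, 0 < u y) →
    ∃ x ∈ Metric.closedBall z R, ∀ v, HasLogLaplacianAt u x v → v < 0 := by
  obtain ⟨R, hR, c, hc, hsub⟩ := exists_tent_subsolution m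
  refine ⟨R, hR, fun z u hu hu0 hpos => ?_⟩
  have hzB : z ∈ Metric.closedBall z R := Metric.mem_closedBall_self hR.le
  obtain ⟨p, hp, hpmin⟩ := (isCompact_closedBall z R).exists_isMinOn ⟨z, hzB⟩ hu.continuousOn
  have hup := hpos p hp
  have huz := hpos z hzB
  have htz : tent R z z = 1 := by simp [tent]
  -- Below the level `δ` the quotient `u / tent` exceeds its value at the centre.
  set δ := u p / u z with hδ
  have hδ0 : 0 < δ := div_pos hup huz
  set S := Metric.closedBall z R ∩ {y | δ ≤ tent R z y} with hS
  have hScomp : IsCompact S := (isCompact_closedBall z R).inter_right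
    (isClosed_le continuous_const (continuous_tent R z))
  have hzS : z ∈ S := ⟨hzB, by
    rw [mem_ofPred_eq, htz]; exact (div_le_one huz).2 (hpmin hzB)⟩
  have htS : ∀ y ∈ S, 0 < tent R z y := fun y hy => hδ0.trans_le hy.2
  obtain ⟨x, hxS, hxmin⟩ := hScomp.exists_isMinOn ⟨z, hzS⟩
    (hu.continuousOn.div (continuous_tent R z).continuousOn fun y hy => (htS y hy).ne')
  set t := u x / tent R z x with ht
  have ht0 : 0 < t := div_pos (hpos x hxS.1) (htS x hxS)
  have htu : t ≤ u z := by
    have := hxmin hzS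
    simpa [htz] using this
  have htx : t * tent R z x = u x := div_mul_cancel₀ _ (htS x hxS).ne'
  have hle : ∀ y, t * tent R z y ≤ u y := by
    intro y
    by_cases hyB : y ∈ Metric.closedBall z R
    · rcases le_or_gt δ (tent R z y) with h | h
      · exact (le_div_iff₀ (hδ0.trans_le h)).1 (hxmin ⟨hyB, h⟩)
      · calc t * tent R z y ≤ u z * δ := mul_le_mul htu h.le (tent_nonneg _ _ _) huz.le
          _ = u p := mul_div_cancel₀ _ huz.ne'
          _ ≤ u y := hpmin hyB
    · rw [tent_eq_zero hR (mem_compl_closedBall.1 hyB).le, mul_zero]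
      exact hu0 y
  have hxR : ‖z - x‖ < R := by
    by_contra h
    exact (htS x hxS).ne' (tent_eq_zero hR (not_lt.1 h))
  refine ⟨x, hxS.1, fun v hv => ?_⟩
  refine lt_of_le_of_lt (le_of_tendsto hv.2 ?_) (mul_neg_of_pos_of_neg ht0 hc)
  have hsmall : ∀ᶠ ε : ℝ in 𝓝[>] 0, ε < 1 := nhdsWithin_le_nhds (Iio_mem_nhds one_pos)
  filter_upwards [hsmall, self_mem_nhdsWithin] with ε hε1 hε
  have hI : ∫ y in (Metric.closedBall x ε)ᶜ, integrand u x y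
      ≤ t * ∫ y in (Metric.closedBall x ε)ᶜ, integrand (tent R z) x y := by
    rw [← integral_const_mul]
    refine integral_mono (hv.1 ε hε) ((integrableOn_integrand_tent hR hε z x).const_mul t)
      fun y => ?_
    simp only [integrand_eq]
    have hind : (Metric.ball x 1).indicator (fun _ => u x) y
        = t * (Metric.ball x 1).indicator (fun _ => tent R z x) y := by
      by_cases hy : y ∈ Metric.ball x 1 <;> simp [hy, htx]
    rw [hind]
    have := mul_le_mul_of_nonneg_right (hle y) (kernel_nonneg x y)
    linarith
  have hmain := mul_le_mul_of_nonneg_left (hsub z x hxR ε hε hε1) ht0.le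
  have hCI := mul_le_mul_of_nonneg_left hI (constC_pos m).le
  rw [← htx]
  linarith

/-! ### Coercive epigraphs -/

lemma IsLipschitzCoercive.continuous {m : ℕ} {φ : E m → ℝ} (hφ : IsLipschitzCoercive φ) :
    Continuous φ := by
  obtain ⟨K, hK⟩ := hφ.lipschitz
  exact hK.continuous

lemma IsLipschitzCoercive.exists_norm_le {m : ℕ} {φ : E m → ℝ} (hφ : IsLipschitzCoercive φ)
    (c : ℝ) : ∃ r, ∀ y, φ y ≤ c → ‖y‖ ≤ r := by
  obtain ⟨r, hr⟩ := eventually_atTop.1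
    (eventually_comap.1 (hφ.coercive.eventually (eventually_gt_atTop c)))
  refine ⟨r, fun y hy => ?_⟩
  by_contra h
  exact absurd (hr ‖y‖ (not_le.1 h).le y rfl) (not_lt.2 hy)

lemma IsLipschitzCoercive.bddBelow {m : ℕ} {φ : E m → ℝ} (hφ : IsLipschitzCoercive φ) :
    BddBelow (range φ) := by
  obtain ⟨r, hr⟩ := hφ.exists_norm_le 0
  obtain ⟨b, hb⟩ := (isCompact_closedBall (0 : E m) r).bddBelow_image hφ.continuous.continuousOn
  refine ⟨min b 0, ?_⟩
  rintro _ ⟨y, rfl⟩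
  rcases le_or_gt (φ y) 0 with h | h
  · exact (min_le_left _ _).trans (hb ⟨y, by simpa using hr y h, rfl⟩)
  · exact (min_le_right _ _).trans h.le

lemma IsLipschitzCoercive.bottom_le {m : ℕ} {φ : E m → ℝ} (hφ : IsLipschitzCoercive φ) (y : E m) :
    bottom φ ≤ φ y := ciInf_le hφ.bddBelow y

lemma IsLipschitzCoercive.bottom_lt_height {m : ℕ} {φ : E m → ℝ} (hφ : IsLipschitzCoercive φ)
    {x : E (m + 1)} (hx : x ∈ epigraph φ) : bottom φ < height x := (hφ.bottom_le _).trans_lt hx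

lemma isOpen_epigraph {m : ℕ} {φ : E m → ℝ} (hφ : Continuous φ) : IsOpen (epigraph φ) :=
  isOpen_lt (hφ.comp continuous_horiz) continuous_height

/-- Coercivity makes the part of the closed epigraph below any height compact. -/
lemma IsLipschitzCoercive.isCompact_cap {m : ℕ} {φ : E m → ℝ} (hφ : IsLipschitzCoercive φ)
    (l : ℝ) : IsCompact {x : E (m + 1) | φ (horiz x) ≤ height x ∧ height x ≤ l} := by
  obtain ⟨r, hr⟩ := hφ.exists_norm_le l
  refine Metric.isCompact_of_isClosed_isBounded
    ((isClosed_le (hφ.continuous.comp continuous_horiz) continuous_height).inter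
      (isClosed_le continuous_height continuous_const)) ?_
  refine (Metric.isBounded_closedBall (x := (0 : E (m + 1)))
    (r := r + (|l| + |bottom φ|))).subset fun x hx => ?_
  rw [mem_closedBall_zero_iff]
  refine (norm_le_add x).trans (add_le_add (hr _ (hx.1.trans hx.2)) ?_)
  have h1 := hφ.bottom_le (horiz x)
  exact abs_le.2 ⟨by linarith [neg_abs_le (bottom φ), abs_nonneg l, hx.1],
    by linarith [le_abs_self l, abs_nonneg (bottom φ), hx.2]⟩

/-- A Lipschitz epigraph contains a cone, hence balls of any radius at any height. -/
lemma IsLipschitzCoercive.exists_closedBall_subset {m : ℕ} {φ : E m → ℝ}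
    (hφ : IsLipschitzCoercive φ) (R t : ℝ) :
    ∃ z, Metric.closedBall z R ⊆ epigraph φ ∩ {x | t < height x} := by
  obtain ⟨K, hK⟩ := hφ.lipschitz
  set H := max (φ 0 + K * R) t + R + 1 with hH
  refine ⟨EuclideanSpace.single (Fin.last m) H, fun x hx => ?_⟩
  set z := EuclideanSpace.single (Fin.last m) H with hz
  have hzh : horiz z = 0 := by
    ext i; simp [hz, horiz, Fin.castSucc_ne_last]
  have hzH : height z = H := by simp [hz, height]
  rw [Metric.mem_closedBall, dist_eq_norm] at hx
  have h1 : ‖horiz x‖ ≤ R := by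
    have := (norm_horiz_le (x - z)).trans hx
    rwa [horiz_sub, hzh, sub_zero] at this
  have h2 := (abs_le.1 ((abs_height_le (x - z)).trans hx)).1
  rw [height_sub, hzH] at h2
  have h3 : φ (horiz x) ≤ φ 0 + K * R := by
    have h := hK.dist_le_mul (horiz x) 0
    rw [Real.dist_eq, dist_zero_right] at h
    have h4 : (K : ℝ) * ‖horiz x‖ ≤ K * R := by gcongr
    linarith [le_abs_self (φ (horiz x) - φ 0)]
  have h5 := le_max_left (φ 0 + K * R) t
  have h6 := le_max_right (φ 0 + K * R) t
  exact ⟨show φ (horiz x) < height x by linarith, show t < height x by linarith⟩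

lemma continuous_of_continuousOn_closure {m : ℕ} {Ω : Set (E (m + 1))} (hΩ : IsOpen Ω)
    {u : E (m + 1) → ℝ} (hu : ContinuousOn u (closure Ω)) (h0 : ∀ x ∉ Ω, u x = 0) :
    Continuous u := by
  rw [← continuousOn_univ, ← union_compl_self Ω]
  refine (hu.union_of_isClosed ?_ isClosed_closure hΩ.isClosed_compl).mono
    (union_subset_union_left _ subset_closure)
  exact continuousOn_const.congr h0

/-! ### Moving planes -/

/-- The difference `w_λ(x) = u(x^λ) - u(x)` between `u` reflected in the hyperplane `x_n = λ` and
`u`. -/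
noncomputable def reflDiff {m : ℕ} (u : E (m + 1) → ℝ) (l : ℝ) (x : E (m + 1)) : ℝ :=
  u (mirror l x) - u x

lemma reflDiff_mirror {m : ℕ} (u : E (m + 1) → ℝ) (l : ℝ) (x : E (m + 1)) :
    reflDiff u l (mirror l x) = -reflDiff u l x := by
  simp [reflDiff]

lemma continuous_reflDiff {m : ℕ} {u : E (m + 1) → ℝ} (hu : Continuous u) (l : ℝ) :
    Continuous (reflDiff u l) := (hu.comp (continuous_mirror l)).sub hu

lemma abs_reflDiff_le {m : ℕ} {u : E (m + 1) → ℝ} {B : ℝ} (hB : ∀ x, |u x| ≤ B) (l : ℝ)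
    (x : E (m + 1)) : |reflDiff u l x| ≤ B + B :=
  (abs_sub _ _).trans (add_le_add (hB _) (hB _))

lemma mirror_mem_epigraph {m : ℕ} {φ : E m → ℝ} {l : ℝ} {x : E (m + 1)} (hx : x ∈ epigraph φ)
    (hl : height x ≤ l) : mirror l x ∈ epigraph φ := by
  have : φ (horiz x) < height x := hx
  simp only [epigraph, mem_ofPred_eq, horiz_mirror, height_mirror]
  linarith

lemma IsSolution.hasLogLaplacianAt_reflDiff {m : ℕ} {φ : E m → ℝ} {a f : ℝ → ℝ}
    {u : E (m + 1) → ℝ} (hu : IsSolution (epigraph φ) a f u) {l : ℝ} {x : E (m + 1)}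
    (hx : x ∈ epigraph φ) (hl : height x ≤ l) :
    HasLogLaplacianAt (reflDiff u l) x
      (a (height (mirror l x)) * f (u (mirror l x)) - a (height x) * f (u x)) :=
  (hu.equation _ (mirror_mem_epigraph hx hl)).comp_mirror.sub (hu.equation x hx)

lemma IsSolution.nonneg {m : ℕ} {φ : E m → ℝ} {a f : ℝ → ℝ} {u : E (m + 1) → ℝ}
    (hu : IsSolution (epigraph φ) a f u) (hpos : ∀ x ∈ epigraph φ, 0 < u x) (x : E (m + 1)) :
    0 ≤ u x := by
  by_cases hx : x ∈ epigraph φ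
  · exact (hpos x hx).le
  · exact (hu.exterior x hx).ge

/-- A positive solution forces the coefficient to be negative: otherwise the solution would have
nonnegative logarithmic Laplacian on arbitrarily large balls. This is what makes the moving plane
argument insensitive to the modulus of continuity of `f` at `0`. -/
lemma IsSolution.coeff_neg {m : ℕ} {φ : E m → ℝ} (hφ : IsLipschitzCoercive φ) {a f : ℝ → ℝ}
    {u : E (m + 1) → ℝ} (hu : IsSolution (epigraph φ) a f u) (hcont : Continuous u)
    (hpos : ∀ x ∈ epigraph φ, 0 < u x) (ha : MonotoneOn a (Ioi (bottom φ)))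
    (hf : ∀ t : ℝ, 0 < t → 0 < f t) {t : ℝ} (ht : bottom φ < t) : a t < 0 := by
  by_contra! hat
  obtain ⟨R, -, hneg⟩ := exists_hasLogLaplacianAt_neg m
  obtain ⟨z, hz⟩ := hφ.exists_closedBall_subset R t
  obtain ⟨x, hx, hxv⟩ := hneg z u hcont (hu.nonneg hpos) fun y hy => hpos y (hz hy).1
  have htx : t < height x := (hz hx).2
  have h1 := hxv _ (hu.equation x (hz hx).1)
  have h2 : a t ≤ a (height x) := ha ht (ht.trans htx) htx.le
  exact absurd (mul_nonneg (hat.trans h2) (hf _ (hpos x (hz hx).1)).le) (not_le.2 h1)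

lemma IsSolution.reflDiff_nonneg_of_notMem {m : ℕ} {φ : E m → ℝ} {a f : ℝ → ℝ}
    {u : E (m + 1) → ℝ} (hu : IsSolution (epigraph φ) a f u) (hpos : ∀ x ∈ epigraph φ, 0 < u x)
    {l : ℝ} {x : E (m + 1)} (hx : x ∉ epigraph φ) : 0 ≤ reflDiff u l x := by
  rw [reflDiff, hu.exterior x hx, sub_zero]
  exact hu.nonneg hpos _

/-- If `w_λ` is negative somewhere on the near side, it attains a negative minimum there, and this
happens inside the epigraph. -/
lemma IsSolution.exists_min_reflDiff {m : ℕ} {φ : E m → ℝ} (hφ : IsLipschitzCoercive φ)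
    {a f : ℝ → ℝ} {u : E (m + 1) → ℝ} (hu : IsSolution (epigraph φ) a f u) (hcont : Continuous u)
    (hpos : ∀ x ∈ epigraph φ, 0 < u x) {l : ℝ} {y : E (m + 1)} (hy : height y < l)
    (hwy : reflDiff u l y < 0) :
    ∃ x ∈ epigraph φ, height x < l ∧ reflDiff u l x < 0 ∧
      ∀ y, height y < l → reflDiff u l x ≤ reflDiff u l y := by
  have hmem : ∀ y, height y < l → reflDiff u l y < 0 → y ∈ epigraph φ := fun y _ hwy => by
    by_contra h
    exact absurd (hu.reflDiff_nonneg_of_notMem hpos h) (not_le.2 hwy)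
  have hcap : ∀ y ∈ epigraph φ, height y < l →
      y ∈ {x : E (m + 1) | φ (horiz x) ≤ height x ∧ height x ≤ l} :=
    fun y hy hyl => ⟨le_of_lt hy, hyl.le⟩
  have hyc := hcap y (hmem y hy hwy) hy
  obtain ⟨x, hx, hxmin⟩ := (hφ.isCompact_cap l).exists_isMinOn ⟨y, hyc⟩
    (continuous_reflDiff hcont l).continuousOn
  have hwx : reflDiff u l x < 0 := (hxmin hyc).trans_lt hwy
  have hxl : height x < l := by
    refine hx.2.lt_of_ne fun h => ?_
    have : mirror l x = x := ext_horiz_height (by simp) (by rw [height_mirror]; linarith)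
    rw [reflDiff, this, sub_self] at hwx
    exact lt_irrefl _ hwx
  refine ⟨x, hmem x hxl hwx, hxl, hwx, fun y hy => ?_⟩
  by_cases hyΩ : y ∈ epigraph φ
  · exact hxmin (hcap y hyΩ hy)
  · exact hwx.le.trans (hu.reflDiff_nonneg_of_notMem hpos hyΩ)

/-- Nonnegativity of `w_λ` on the near side improves to positivity in the epigraph. -/
lemma IsSolution.reflDiff_pos {m : ℕ} {φ : E m → ℝ} (hφ : IsLipschitzCoercive φ) {a f : ℝ → ℝ}
    {u : E (m + 1) → ℝ} {B : ℝ} (hu : IsSolution (epigraph φ) a f u) (hcont : Continuous u)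
    (hB : ∀ x, |u x| ≤ B) (hpos : ∀ x ∈ epigraph φ, 0 < u x)
    (ha : MonotoneOn a (Ioi (bottom φ))) (hf : ∀ t : ℝ, 0 < t → 0 < f t) {l : ℝ}
    (hl : bottom φ < l) (hnonneg : ∀ y, height y < l → 0 ≤ reflDiff u l y) {x : E (m + 1)}
    (hx : x ∈ epigraph φ) (hxl : height x < l) : 0 < reflDiff u l x := by
  refine (hnonneg x hxl).lt_of_ne' fun h0 => ?_
  -- A point on the graph of `φ` below the hyperplane: `u` vanishes there, but not at its mirror
  -- image.
  obtain ⟨y', hy'⟩ := exists_lt_of_ciInf_lt hl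
  set y : E (m + 1) := WithLp.toLp 2 (Fin.snoc (α := fun _ => ℝ) (WithLp.ofLp y') (φ y')) with hy
  have hyh : horiz y = y' := by ext i; simp [hy, horiz]
  have hyH : height y = φ y' := by simp [hy, height]
  have hyΩ : y ∉ epigraph φ := by simp [epigraph, hyh, hyH]
  have hyl : height y < l := hyH ▸ hy'
  have hmΩ : mirror l y ∈ epigraph φ := by
    simp only [epigraph, mem_ofPred_eq, horiz_mirror, height_mirror, hyh, hyH]
    linarith
  have hwy : 0 < reflDiff u l y := by
    rw [reflDiff, hu.exterior y hyΩ, sub_zero]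
    exact hpos _ hmΩ
  have hneg := (hu.hasLogLaplacianAt_reflDiff hx hxl.le).neg_of_antisymm
    (continuous_reflDiff hcont l) (reflDiff_mirror u l) (abs_reflDiff_le hB l) hxl h0 hnonneg hyl
    hwy
  have hux : u (mirror l x) = u x := sub_eq_zero.1 h0
  have hbx := hφ.bottom_lt_height hx
  have hmx : height x ≤ height (mirror l x) := by rw [height_mirror]; linarith
  have hax := ha hbx (hbx.trans_le hmx) hmx
  rw [hux, ← sub_mul] at hneg
  exact absurd (mul_nonneg (sub_nonneg.2 hax) (hf _ (hpos x hx)).le) (not_le.2 hneg)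

/-- The plane can be moved upwards a little from any position `l` at which `w_l` is positive in the
part of the epigraph below the plane, because the volume of the set where `w_λ` is negative tends
to `0` as `λ` decreases to `l`. -/
lemma IsSolution.eventually_reflDiff_nonneg {m : ℕ} {φ : E m → ℝ} (hφ : IsLipschitzCoercive φ)
    {a f : ℝ → ℝ} {u : E (m + 1) → ℝ} {B : ℝ} (hu : IsSolution (epigraph φ) a f u)
    (hcont : Continuous u) (hB : ∀ x, |u x| ≤ B) (hpos : ∀ x ∈ epigraph φ, 0 < u x)
    (ha : MonotoneOn a (Ioi (bottom φ))) (hf_mono : MonotoneOn f (Ioi 0))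
    (hf : ∀ t : ℝ, 0 < t → 0 < f t) {l : ℝ}
    (hl : ∀ x ∈ epigraph φ, height x < l → 0 < reflDiff u l x) :
    ∀ᶠ μ in 𝓝[>] l, ∀ y, height y < μ → 0 ≤ reflDiff u μ y := by
  obtain ⟨δ, hδ, hthr⟩ := exists_volume_threshold m
  have hmeas (μ : ℝ) : MeasurableSet {y : E (m + 1) | height y < μ ∧ reflDiff u μ y < 0} :=
    ((isOpen_Iio.preimage continuous_height).inter
      (isOpen_Iio.preimage (continuous_reflDiff hcont μ))).measurableSet
  have hcap := hφ.isCompact_cap (l + 1)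
  have hlim : Tendsto (fun μ => volume {y : E (m + 1) | height y < μ ∧ reflDiff u μ y < 0})
      (𝓝[>] l) (𝓝 (volume (∅ : Set (E (m + 1))))) := by
    refine tendsto_measure_of_ae_tendsto_indicator _ MeasurableSet.empty hmeas
      hcap.measurableSet hcap.measure_lt_top.ne ?_ ?_
    · have hsm : ∀ᶠ μ : ℝ in 𝓝[>] l, μ < l + 1 := nhdsWithin_le_nhds (Iio_mem_nhds (by linarith))
      filter_upwards [hsm] with μ hμ y hy
      have hyΩ : y ∈ epigraph φ := by
        by_contra h
        exact absurd (hu.reflDiff_nonneg_of_notMem hpos h) (not_le.2 hy.2)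
      exact ⟨le_of_lt hyΩ, hy.1.le.trans hμ.le⟩
    · have hne : ∀ᵐ y : E (m + 1), height y ≠ l := by
        rw [ae_iff]; simpa using volume_hyperplane l
      filter_upwards [hne] with y hyl
      simp only [mem_empty_iff_false, iff_false, not_and, not_lt]
      rcases hyl.lt_or_gt with hy | hy
      · by_cases hyΩ : y ∈ epigraph φ
        · have hc : Continuous fun μ => reflDiff u μ y :=
            (hcont.comp (continuous_mirror_left y)).sub continuous_const
          have := nhdsWithin_le_nhds (s := Ioi l)
            (hc.continuousAt.eventually (lt_mem_nhds (hl y hyΩ hy)))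
          filter_upwards [this] with μ hμ _
          exact hμ.le
        · exact Eventually.of_forall fun μ _ => hu.reflDiff_nonneg_of_notMem hpos hyΩ
      · filter_upwards [nhdsWithin_le_nhds (Iio_mem_nhds hy)] with μ hμ hμ'
        exact absurd hμ' (not_lt.2 (le_of_lt hμ))
  rw [measure_empty] at hlim
  filter_upwards [hlim.eventually (ge_mem_nhds (ENNReal.ofReal_pos.2 hδ))] with μ hμ
  by_contra! hex
  obtain ⟨y, hy, hwy⟩ := hex
  obtain ⟨x, hx, hxμ, hwx, hmin⟩ := hu.exists_min_reflDiff hφ hcont hpos hy hwy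
  have hneg := hthr μ (B + B) _ x (reflDiff u μ) (continuous_reflDiff hcont μ)
    (reflDiff_mirror u μ) (abs_reflDiff_le hB μ) hxμ hwx hmin hμ
    (hu.hasLogLaplacianAt_reflDiff hx hxμ.le)
  have hbx := hφ.bottom_lt_height hx
  have hmx : height x ≤ height (mirror μ x) := by rw [height_mirror]; linarith
  have hax := ha hbx (hbx.trans_le hmx) hmx
  have hmΩ := mirror_mem_epigraph hx hxμ.le
  have hum : u (mirror μ x) ≤ u x := (sub_neg.1 hwx).le
  have hfm := hf_mono (hpos _ hmΩ) (hpos x hx) hum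
  have hfp := hf _ (hpos _ hmΩ)
  have hax0 := hu.coeff_neg hφ hcont hpos ha hf hbx
  -- As `a(x_n) < 0`, monotonicity gives
  -- `a(x_n) f(u(x)) ≤ a(x_n) f(u(x^μ)) ≤ a(2μ - x_n) f(u(x^μ))`.
  nlinarith

/-- The plane can be moved through all positions above the lowest point of the epigraph. -/
lemma IsSolution.reflDiff_nonneg {m : ℕ} {φ : E m → ℝ} (hφ : IsLipschitzCoercive φ)
    {a f : ℝ → ℝ} {u : E (m + 1) → ℝ} {B : ℝ} (hu : IsSolution (epigraph φ) a f u)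
    (hcont : Continuous u) (hB : ∀ x, |u x| ≤ B) (hpos : ∀ x ∈ epigraph φ, 0 < u x)
    (ha : MonotoneOn a (Ioi (bottom φ))) (hf_mono : MonotoneOn f (Ioi 0))
    (hf : ∀ t : ℝ, 0 < t → 0 < f t) {l : ℝ} (hl : bottom φ < l) {y : E (m + 1)}
    (hy : height y < l) : 0 ≤ reflDiff u l y := by
  by_contra! hneg
  -- `Λ` is the first position beyond which the inequality fails.
  set S := {l | bottom φ < l ∧ ∃ y, height y < l ∧ reflDiff u l y < 0} with hS
  have hSne : S.Nonempty := ⟨l, hl, y, hy, hneg⟩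
  have hSb : bottom φ ∈ lowerBounds S := fun μ hμ => hμ.1.le
  set Λ := sInf S with hΛ
  have hbΛ : bottom φ ≤ Λ := le_csInf hSne hSb
  have hgood : ∀ μ, bottom φ < μ → μ < Λ → ∀ y, height y < μ → 0 ≤ reflDiff u μ y := by
    intro μ hbμ hμ y hy
    by_contra! h
    exact absurd (csInf_le ⟨_, hSb⟩ (show μ ∈ S from ⟨hbμ, y, hy, h⟩)) (not_le.2 hμ)
  have hposΛ : ∀ x ∈ epigraph φ, height x < Λ → 0 < reflDiff u Λ x := by
    intro x hx hxΛ
    have hbΛ' : bottom φ < Λ := (hφ.bottom_lt_height hx).trans hxΛ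
    refine hu.reflDiff_pos hφ hcont hB hpos ha hf hbΛ' (fun y hy => ?_) hx hxΛ
    have hc : Continuous fun μ => reflDiff u μ y :=
      (hcont.comp (continuous_mirror_left y)).sub continuous_const
    refine ge_of_tendsto ((hc.tendsto Λ).mono_left (nhdsWithin_le_nhds (s := Iio Λ))) ?_
    filter_upwards [self_mem_nhdsWithin, nhdsWithin_le_nhds (lt_mem_nhds hbΛ'),
      nhdsWithin_le_nhds (lt_mem_nhds hy)] with μ h1 h2 h3
    exact hgood μ h2 h1 y h3
  have hright := hu.eventually_reflDiff_nonneg hφ hcont hB hpos ha hf_mono hf hposΛ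
  obtain ⟨μ, hμ, hIoo⟩ := mem_nhdsGT_iff_exists_Ioo_subset.1 hright
  obtain ⟨ν, hνS, hνμ⟩ := exists_lt_of_csInf_lt hSne hμ
  have hΛle : Λ ≤ ν := csInf_le ⟨_, hSb⟩ hνS
  obtain ⟨hbν, y, hyν, hwy⟩ := hνS
  rcases hΛle.lt_or_eq with h | hΛν
  · exact absurd (hIoo ⟨h, hνμ⟩ y hyν) (not_le.2 hwy)
  · obtain ⟨x, hx, hxν, hwx, -⟩ := hu.exists_min_reflDiff hφ hcont hpos hyν hwy
    rw [← hΛν] at hxν hwx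
    exact lt_asymm hwx (hposΛ x hx hxν)

end LogLap

theorem theorem1 {m : ℕ} (φ : LogLap.E m → ℝ) (hφ : LogLap.IsLipschitzCoercive φ)
    (a f : ℝ → ℝ) (u : LogLap.E (m + 1) → ℝ)
    (hu_L0 : LogLap.MemL0 u)
    (hu_C11 : LogLap.IsC11Loc u (LogLap.epigraph φ))
    (hu_cont : ContinuousOn u (closure (LogLap.epigraph φ)))
    (hu_pos : ∀ x ∈ LogLap.epigraph φ, 0 < u x)
    (hu_bdd : ∃ B : ℝ, ∀ x, |u x| ≤ B)
    (hu_sol : LogLap.IsSolution (LogLap.epigraph φ) a f u)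
    (ha_cont : ContinuousOn a (Ioi (LogLap.bottom φ)))
    (ha_mono : MonotoneOn a (Ioi (LogLap.bottom φ)))
    (ha_lim : limsup (fun h : ℝ => ((a (LogLap.bottom φ + h) / (-Real.log h) : ℝ) : EReal))
      (𝓝[>] 0) ≤ 0)
    (hf_lip : LocallyLipschitzOn (Ioi 0) f)
    (hf_mono : MonotoneOn f (Ioi 0))
    (hf_pos : ∀ t : ℝ, 0 < t → 0 < f t) :
    ∀ x ∈ LogLap.epigraph φ, ∀ y ∈ LogLap.epigraph φ,
      LogLap.horiz x = LogLap.horiz y → LogLap.height x < LogLap.height y → u x < u y := by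
  intro x hx y _ hxy hlt
  obtain ⟨B, hB⟩ := hu_bdd
  have hcont : Continuous u := LogLap.continuous_of_continuousOn_closure
    (LogLap.isOpen_epigraph hφ.continuous) hu_cont hu_sol.exterior
  have hxl : LogLap.height x < (LogLap.height x + LogLap.height y) / 2 := by linarith
  have hl := (hφ.bottom_lt_height hx).trans hxl
  have hpos := hu_sol.reflDiff_pos hφ hcont hB hu_pos ha_mono hf_pos hl
    (fun z hz => hu_sol.reflDiff_nonneg hφ hcont hB hu_pos ha_mono hf_mono hf_pos hl hz) hx hxl
  have hmirror : LogLap.mirror ((LogLap.height x + LogLap.height y) / 2) x = y :=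
    LogLap.ext_horiz_height (by simpa using hxy) (by rw [LogLap.height_mirror]; ring)
  rw [LogLap.reflDiff, hmirror] at hpos
  exact sub_pos.1 hpos
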